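/- A one-way nondeterministic $2$-counter machine $M=(Q,\Sigma,\delta,q_0,F)$ has a finite state set $Q$, a finite input alphabet $\Sigma$, an initial state $q_0\in Q$, a set $F\subseteq Q$ of final states, and a set $\delta\subseteq Q\times(\Sigma\cup\{\lambda,\triangleleft\})\times\{1,2\}\times\{0,1\}\times Q\times\{-1,0,+1\}$ of transitions, where $\lambda$ is the empty word and $\triangleleft$ is the right end-of-input marker. A configuration $(q,w,z_1,z_2)$ consists of the current state, the remaining input $w\in\Sigma^*\triangleleft\cup\{\lambda\}$ and the counter values $z_1,z_2\in\mathbb{N}_0$. A transition $(q,a,i,s,q',d)\in\delta$ is applicable in the configurations $(q,aw,z_1,z_2)$ for which $s=0$ if $z_i=0$ and $s=1$ if $z_i>0$; if $z_i+d\ge 0$, it leads to the configuration with state $q'$ and remaining input $w$ in which $z_i$ is replaced by $z_i+d$ and the other counter is unchanged. $M$ is deterministic if in every configuration at most one transition is applicable. A computation on $w\in\Sigma^*$ starts in $(q_0,w\triangleleft,0,0)$; it is accepting if it ends in a configuration whose state is in $F$ and whose remaining input is $\lambda$. $L(M)$ is the set of all $w\in\Sigma^*$ on which $M$ has an accepting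 computation. The store language $S(M)$ is the set of all words $qC_1^{z_1}C_2^{z_2}$ over the alphabet $Q\cup\{C_1,C_2\}$ (where $C_1,C_2$ are new symbols) such that some configuration $(q,w',z_1,z_2)$ occurs in an accepting computation of $M$ on some input. **Proposition.** (1) There is a one-way deterministic $2$-counter machine whose store language is not recursive. (2) There is a one-way nondeterministic $2$-counter machine $M$ with $L(M)=\{\lambda\}$ whose store language is not recursive. -/

import Mathlib

/-- A symbol on the input tape: a letter of the input alphabet, or the right end-of-input marker. -/
inductive TapeSymbol (A : Type) : Type
  | letter (a : A)
  | endMarker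

/-- A transition of a one-way machine with `t` counters, state set `Q` and input alphabet `A`.
`read = none` means that no input symbol is consumed (a `λ`-transition). The transition tests
the single counter `counter` (`positive = false`: the counter is `0`; `positive = true`: it is not)
and adds `add ∈ {-1, 0, 1}` to it. -/
structure CounterTransition (Q A : Type) (t : ℕ) : Type where
  source : Q
  read : Option (TapeSymbol A)
  counter : Fin t
  positive : Bool
  target : Q
  add : SignType

/-- A one-way nondeterministic machine with `t` counters (and no worktape). `Q` and `A` are
required to be finite where machines are quantified over; the set of transitions is then finite. -/
structure CounterMachine (Q A : Type) (t : ℕ) : Type where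
  transitions : Set (CounterTransition Q A t)
  start : Q
  final : Set Q

/-- A configuration: current state, remaining input (including the end marker), counter values. -/
structure CounterConfig (Q A : Type) (t : ℕ) : Type where
  state : Q
  input : List (TapeSymbol A)
  counters : Fin t → ℕ

/-- The transition `e` is applicable in `c`, as far as state, input and counter test go. -/
def CounterTransition.Enabled {Q A : Type} {t : ℕ} (e : CounterTransition Q A t)
    (c : CounterConfig Q A t) : Prop :=
  c.state = e.source ∧ e.read.toList <+: c.input ∧ (0 < c.counters e.counter ↔ e.positive = true)

namespace CounterMachine

variable {Q A : Type} {t : ℕ} (M : CounterMachine Q A t)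

/-- One move `c ⊢ c'`. Counters stay non-negative, so that a transition that would
decrease a counter with value `0` yields no move. -/
def Step (c c' : CounterConfig Q A t) : Prop :=
  ∃ e ∈ M.transitions, e.Enabled c ∧
    c'.state = e.target ∧
    c.input = e.read.toList ++ c'.input ∧
    ∀ i, (c'.counters i : ℤ) = (c.counters i : ℤ) + if i = e.counter then (e.add : ℤ) else 0

/-- Zero or more moves. -/
def Reaches : CounterConfig Q A t → CounterConfig Q A t → Prop :=
  Relation.ReflTransGen M.Step

/-- At most one transition is applicable in every configuration. -/
def Deterministic : Prop :=
  ∀ c : CounterConfig Q A t, ∀ e₁ ∈ M.transitions, ∀ e₂ ∈ M.transitions,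
    e₁.Enabled c → e₂.Enabled c → e₁ = e₂

/-- The initial configuration on input `w`: the input tape holds `w` and the end marker, and all
counters are zero. -/
def init (w : List A) : CounterConfig Q A t where
  state := M.start
  input := w.map TapeSymbol.letter ++ [TapeSymbol.endMarker]
  counters := fun _ => 0

/-- The state is final and the whole input, including the end marker, has been read. -/
def Accepting (c : CounterConfig Q A t) : Prop :=
  c.state ∈ M.final ∧ c.input = []

/-- The language accepted by `M`. -/
def acceptedLanguage : Language A :=
  {w | ∃ f, M.Reaches (M.init w) f ∧ M.Accepting f}

/-- The store configuration `q C₁ ^ z₁ ⋯ C_t ^ z_t`, a word over the alphabet `Q ⊕ Fin t`, in which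
`Sum.inr i` is the counter symbol of counter `i`. -/
def storeWord (c : CounterConfig Q A t) : List (Q ⊕ Fin t) :=
  Sum.inl c.state ::
    (List.finRange t).flatMap fun i => List.replicate (c.counters i) (Sum.inr i)

/-- The store language: all store configurations that occur in accepting computations. -/
def storeLanguage : Language (Q ⊕ Fin t) :=
  {s | ∃ (w : List A) (c f : CounterConfig Q A t),
    M.Reaches (M.init w) c ∧ M.Reaches c f ∧ M.Accepting f ∧ s = storeWord c}

end CounterMachine

/-- A language over a finite alphabet is recursive if membership is decidable once the letters are
numbered. All numberings give the same notion, as a permutation of finitely many letters is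
computable. -/
def Language.IsRecursive {α : Type} (L : Language α) : Prop :=
  ∃ (n : ℕ) (e : α ≃ Fin n), ComputablePred fun w : List (Fin n) => w.map e.symm ∈ L

/-! Both machines load some `x` into the first counter in the start state and, after the end marker,
run a fixed two-counter program `D` from `q₀`, accepting in `qf`. A store word shows state and
counters but not the history, so `q₀ C₁^x` is in the store language exactly when `D` started on `(x,
0)` reaches `qf` (`storeWord_mem_counting`). For (1), `x` is the input length; for (2), `x` is
guessed by λ-moves, so that only the empty word can be accepted.

It remains to find `D` with an undecidable halting problem (`exists_universal`). Step-bounded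
evaluation is primitive recursive, hence computed by a structured register program
(`computable_of_primrec`); one outer loop searches for a sufficient bound. Such programs run on two
counters (`exists_implements`): counter `0` holds the Gödel number `∏ p_r ^ s_r`, and counter `1` is
scratch space for multiplying and dividing. Code number `n` becomes `x = 2 ^ n * 5`, which reduces
the halting problem to the store language (`not_isRecursive_of_halting`). -/

/-! ### Two-counter programs: multiplication and division blocks. -/

/-- An instruction of a two-counter machine without input. -/
inductive MinskyInstr (Q : Type) : Type
  | inc (i : Fin 2) (q : Q)
  | dec (i : Fin 2) (pos zero : Q)
  | halt

namespace MinskyInstr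

variable {Q : Type}

/-- Relabelling of the jump targets. -/
def map {R : Type} (ℓ : Q → R) : MinskyInstr Q → MinskyInstr R
  | inc i q => inc i (ℓ q)
  | dec i q r => dec i (ℓ q) (ℓ r)
  | halt => halt

/-- The effect of an instruction on the counters, with the next state. -/
def exec : MinskyInstr Q → (Fin 2 → ℕ) → Option (Q × (Fin 2 → ℕ))
  | inc i q, z => some (q, Function.update z i (z i + 1))
  | dec i q r, z => if z i = 0 then some (r, z) else some (q, Function.update z i (z i - 1))
  | halt, _ => none

end MinskyInstr

namespace Minsky

open MinskyInstr Relation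

variable {Q : Type} {D : Q → MinskyInstr Q} {ℓ : ℕ → Q}

/-- One move of the two-counter machine with program `D`. -/
def Step (D : Q → MinskyInstr Q) (c c' : Q × (Fin 2 → ℕ)) : Prop :=
  (D c.1).exec c.2 = some c'

theorem Step.unique {a b c : Q × (Fin 2 → ℕ)} (h : Step D a b) (h' : Step D a c) : b = c :=
  Option.some.inj (h.symm.trans h')

theorem step_inc {q q' : Q} {i : Fin 2} (h : D q = inc i q') (z : Fin 2 → ℕ) :
    Step D (q, z) (q', Function.update z i (z i + 1)) := by
  simp [Step, h, exec]

theorem step_dec_zero {q q₁ q₂ : Q} {i : Fin 2} (h : D q = dec i q₁ q₂) {z : Fin 2 → ℕ}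
    (hz : z i = 0) : Step D (q, z) (q₂, z) := by
  simp [Step, h, exec, hz]

theorem step_dec_pos {q q₁ q₂ : Q} {i : Fin 2} (h : D q = dec i q₁ q₂) {z : Fin 2 → ℕ}
    (hz : z i ≠ 0) : Step D (q, z) (q₁, Function.update z i (z i - 1)) := by
  simp [Step, h, exec, hz]

/-- A configuration in a set every member of which leads by at least one move to another member
does not halt. -/
theorem not_halts_of_invariant {I : Q × (Fin 2 → ℕ) → Prop}
    (hI : ∀ a, I a → ∃ b, I b ∧ TransGen (Step D) a b) {a f : Q × (Fin 2 → ℕ)} (ha : I a)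
    (hf : D f.1 = halt) : ¬ ReflTransGen (Step D) a f := by
  intro h
  -- Moves are deterministic, so the run to `f` and the path to `b` share their first move; when
  -- that path is used up, the invariant extends it.
  suffices H : ∀ c, ReflTransGen (Step D) c f → ∀ b, TransGen (Step D) c b → ¬ I b by
    obtain ⟨b, hb, hab⟩ := hI a ha
    exact H a h b hab hb
  intro c hc
  induction hc using ReflTransGen.head_induction_on with
  | refl =>
    intro b hb
    obtain ⟨d, hd, -⟩ := TransGen.head'_iff.mp hb
    simp [Step, hf, exec] at hd
  | head h _ ih =>
    intro b hb hIb
    obtain ⟨d, hd, hdb⟩ := TransGen.head'_iff.mp hb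
    obtain rfl := h.unique hd
    obtain ⟨b', hb', hbb'⟩ := hI b hIb
    exact ih b' (TransGen.trans_right hdb hbb') hb'

/-- The program `D` contains, under the labelling `ℓ`, the block `δ` at the addresses from `a` up
to `b`. -/
def Contains (D : Q → MinskyInstr Q) (ℓ : ℕ → Q) (δ : ℕ → MinskyInstr ℕ) (a b : ℕ) : Prop :=
  ∀ x, a ≤ x → x < b → D (ℓ x) = (δ x).map ℓ

theorem Contains.restrict {δ δ' : ℕ → MinskyInstr ℕ} {a b a' b' : ℕ} (h : Contains D ℓ δ a b)
    (ha : a ≤ a') (hb : b' ≤ b) (hδ : ∀ x, a' ≤ x → x < b' → δ x = δ' x) :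
    Contains D ℓ δ' a' b' := fun x h₁ h₂ => by
  rw [h x (ha.trans h₁) (h₂.trans_le hb), hδ x h₁ h₂]

/-- The block at the addresses `a, …, a + n` that empties counter `i`, adding `n` to counter `j`
each time, and leaves to `out`. -/
def drain (n : ℕ) (i j : Fin 2) (a out x : ℕ) : MinskyInstr ℕ :=
  if x = a then dec i (a + n) out else inc j (x - 1)

section Drain

variable {n a out : ℕ} {i j : Fin 2}

/-- The increments run downwards to `a`, so the entry address determines how much is added.
`divBlock_not_dvd` enters in the middle to restore a remainder. -/
theorem drain_chain (h : Contains D ℓ (drain n i j a out) a (a + n + 1)) {m : ℕ} (hm : m ≤ n)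
    (z : Fin 2 → ℕ) :
    ReflTransGen (Step D) (ℓ (a + m), z) (ℓ a, Function.update z j (z j + m)) := by
  induction m generalizing z with
  | zero => simpa using ReflTransGen.refl
  | succ m ih =>
    have hx : D (ℓ (a + (m + 1))) = inc j (ℓ (a + m)) := by
      rw [h _ (by omega) (by omega), drain, if_neg (by omega)]
      rfl
    refine ReflTransGen.head (step_inc hx z) ?_
    have := ih (by omega) (Function.update z j (z j + 1))
    simpa [add_assoc, add_comm 1 m] using this

theorem drain_reaches (h : Contains D ℓ (drain n i j a out) a (a + n + 1)) (hij : i ≠ j)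
    (z : Fin 2 → ℕ) :
    ReflTransGen (Step D) (ℓ a, z)
      (ℓ out, Function.update (Function.update z i 0) j (z j + n * z i)) := by
  have hx : D (ℓ a) = dec i (ℓ (a + n)) (ℓ out) := by
    rw [h _ le_rfl (by omega), drain, if_pos rfl]
    rfl
  induction hk : z i generalizing z with
  | zero =>
    refine ReflTransGen.single ?_
    convert step_dec_zero hx hk using 2
    funext k
    simp only [Function.update_apply]
    grind
  | succ k ih =>
    refine ReflTransGen.head (step_dec_pos hx (by omega))
      ((drain_chain h le_rfl _).trans ?_)
    have := ih (Function.update (Function.update z i (z i - 1)) j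
      (Function.update z i (z i - 1) j + n)) (by simp [hij, hk])
    convert this using 2
    funext k
    simp only [Function.update_apply]
    grind

end Drain

theorem update_pair_zero (x y v : ℕ) : Function.update ![x, y] 0 v = ![v, y] := by
  funext k; fin_cases k <;> simp

theorem update_pair_one (x y v : ℕ) : Function.update ![x, y] 1 v = ![x, v] := by
  funext k; fin_cases k <;> simp

theorem drain_zero_one {n a out : ℕ} (h : Contains D ℓ (drain n 0 1 a out) a (a + n + 1))
    (x y : ℕ) : ReflTransGen (Step D) (ℓ a, ![x, y]) (ℓ out, ![0, y + n * x]) := by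
  simpa [update_pair_zero, update_pair_one] using drain_reaches h (by decide) ![x, y]

theorem drain_one_zero {n a out : ℕ} (h : Contains D ℓ (drain n 1 0 a out) a (a + n + 1))
    (x y : ℕ) : ReflTransGen (Step D) (ℓ a, ![x, y]) (ℓ out, ![x + n * y, 0]) := by
  simpa [update_pair_zero, update_pair_one] using drain_reaches h (by decide) ![x, y]

/-- The block at `a, …, a + p + 2` that multiplies counter `0` by `p`. -/
def mulBlock (p a x : ℕ) : MinskyInstr ℕ :=
  if x < a + p + 1 then drain p 0 1 a (a + p + 1) x else drain 1 1 0 (a + p + 1) (a + p + 3) x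

theorem mulBlock_reaches {p a : ℕ} (h : Contains D ℓ (mulBlock p a) a (a + p + 3)) (x : ℕ) :
    ReflTransGen (Step D) (ℓ a, ![x, 0]) (ℓ (a + p + 3), ![p * x, 0]) := by
  have h₁ : Contains D ℓ (drain p 0 1 a (a + p + 1)) a (a + p + 1) :=
    h.restrict le_rfl (by omega) fun x _ hx => if_pos hx
  have h₂ : Contains D ℓ (drain 1 1 0 (a + p + 1) (a + p + 3)) (a + p + 1) (a + p + 1 + 1 + 1) :=
    h.restrict (by omega) (by omega) fun x hx _ => if_neg (by omega)
  simpa using (drain_zero_one h₁ x 0).trans (drain_one_zero h₂ 0 _)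

/-- The block at `a, …, a + 2 * p + 3` that divides counter `0` by `p` and leaves to its end if
`p` divides the counter, and otherwise leaves to `out` with the counter unchanged. -/
def divBlock (p a out x : ℕ) : MinskyInstr ℕ :=
  if x < a + p then dec 0 (x + 1) (if x = a then a + 2 * p + 2 else x + p + 1)
  else if x = a + p then inc 1 a
  else if x < a + 2 * p + 2 then drain p 1 0 (a + p + 1) out x
  else drain 1 1 0 (a + 2 * p + 2) (a + 2 * p + 4) x

section Div

variable {p a out : ℕ}

/-- The address serves as memory: being at `a + j` records that `j` units have been removed in the
current pass. -/
theorem divBlock_drop (h : Contains D ℓ (divBlock p a out) a (a + 2 * p + 4)) {j : ℕ}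
    (hj : j ≤ p) (x y : ℕ) :
    ReflTransGen (Step D) (ℓ a, ![x + j, y]) (ℓ (a + j), ![x, y]) := by
  induction j generalizing x with
  | zero => exact ReflTransGen.refl
  | succ j ih =>
    have hd : D (ℓ (a + j)) = dec 0 (ℓ (a + (j + 1)))
        (ℓ (if a + j = a then a + 2 * p + 2 else a + j + p + 1)) := by
      rw [h _ (by omega) (by omega), divBlock, if_pos (by omega)]
      rfl
    have := ih (by omega) (x + 1)
    rw [add_assoc, add_comm 1] at this
    refine this.tail ?_
    have := step_dec_pos hd (z := ![x + 1, y]) (by simp)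
    simpa [update_pair_zero] using this

theorem divBlock_quotient (h : Contains D ℓ (divBlock p a out) a (a + 2 * p + 4)) (hp : 0 < p)
    (x y k : ℕ) :
    ReflTransGen (Step D) (ℓ a, ![x + p * k, y]) (ℓ a, ![x, y + k]) := by
  induction k generalizing y with
  | zero => exact ReflTransGen.refl
  | succ k ih =>
    have hd : D (ℓ (a + p)) = inc 1 (ℓ a) := by
      rw [h _ (by omega) (by omega), divBlock, if_neg (by omega), if_pos rfl]
      rfl
    rw [mul_add, mul_one, ← add_assoc]
    refine (divBlock_drop h le_rfl (x + p * k) y).trans (ReflTransGen.head (step_inc hd _) ?_)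
    have := ih (y + 1)
    simpa [update_pair_one, add_assoc, add_comm 1 k] using this

theorem divBlock_dvd (h : Contains D ℓ (divBlock p a out) a (a + 2 * p + 4)) (hp : 0 < p)
    (k : ℕ) :
    TransGen (Step D) (ℓ a, ![p * k, 0]) (ℓ (a + 2 * p + 4), ![k, 0]) := by
  have hd : D (ℓ a) = dec 0 (ℓ (a + 1)) (ℓ (a + 2 * p + 2)) := by
    rw [h _ (by omega) (by omega), divBlock, if_pos (by omega), if_pos rfl]
    rfl
  have h₁ : Contains D ℓ (drain 1 1 0 (a + 2 * p + 2) (a + 2 * p + 4)) (a + 2 * p + 2)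
      (a + 2 * p + 2 + 1 + 1) :=
    h.restrict (by omega) (by omega) fun x hx _ => by
      rw [divBlock, if_neg (by omega), if_neg (by omega), if_neg (by omega)]
  have h₂ := divBlock_quotient h hp 0 0 k
  rw [zero_add, zero_add] at h₂
  refine TransGen.trans_right h₂ (TransGen.head' (step_dec_zero hd (by simp)) ?_)
  simpa using drain_one_zero h₁ 0 k

/-- Counter `0` runs out at address `a + x % p`. The exit from there enters the restoring drain at
offset `x % p`, which first returns the remainder and then `p` times the quotient. -/
theorem divBlock_not_dvd (h : Contains D ℓ (divBlock p a out) a (a + 2 * p + 4)) (hp : 0 < p)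
    {x : ℕ} (hx : ¬ p ∣ x) :
    ReflTransGen (Step D) (ℓ a, ![x, 0]) (ℓ out, ![x, 0]) := by
  have hr : x % p ≠ 0 := fun h => hx (Nat.dvd_of_mod_eq_zero h)
  have hlt := Nat.mod_lt x hp
  have hd : D (ℓ (a + x % p)) = dec 0 (ℓ (a + x % p + 1)) (ℓ (a + p + 1 + x % p)) := by
    rw [h _ (by omega) (by omega), divBlock, if_pos (by omega), if_neg (by omega),
      show a + x % p + p + 1 = a + p + 1 + x % p by omega]
    rfl
  have h₁ : Contains D ℓ (drain p 1 0 (a + p + 1) out) (a + p + 1) (a + p + 1 + p + 1) :=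
    h.restrict (by omega) (by omega) fun x hx _ => by
      rw [divBlock, if_neg (by omega), if_neg (by omega), if_pos (by omega)]
  have h₂ := divBlock_quotient h hp (x % p) 0 (x / p)
  have h₃ := divBlock_drop h hlt.le 0 (x / p)
  have h₄ := drain_chain h₁ hlt.le ![0, x / p]
  rw [Nat.mod_add_div, zero_add] at h₂
  rw [zero_add] at h₃
  simp only [update_pair_zero, Matrix.cons_val_zero, zero_add] at h₄
  have h₅ := drain_one_zero h₁ (x % p) (x / p)
  rw [Nat.mod_add_div] at h₅
  exact h₂.trans (h₃.trans (ReflTransGen.head (step_dec_zero hd (by simp)) (h₄.trans h₅)))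

end Div

end Minsky

/-! ### Register programs and their simulation on Gödel numbers. -/

/-- Structured programs over registers `0, 1, 2, …`; `loop r P` stands for
"while register `r` is positive, decrement it and run `P`". -/
inductive RegisterProgram : Type
  | skip
  | inc (r : ℕ)
  | seq (P R : RegisterProgram)
  | loop (r : ℕ) (P : RegisterProgram)

namespace RegisterProgram

/-- `P.Eval s s'`: started with register contents `s`, the program `P` stops with `s'`. -/
inductive Eval : RegisterProgram → (ℕ →₀ ℕ) → (ℕ →₀ ℕ) → Prop
  | skip {s} : Eval skip s s
  | inc {r s} : Eval (inc r) s (s.update r (s r + 1))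
  | seq {P R s s' s''} : Eval P s s' → Eval R s' s'' → Eval (seq P R) s s''
  | loop_zero {r P s} : s r = 0 → Eval (loop r P) s s
  | loop_pos {r P s s' s''} : s r ≠ 0 → Eval P (s.update r (s r - 1)) s' →
      Eval (loop r P) s' s'' → Eval (loop r P) s s''

end RegisterProgram

namespace Minsky

open MinskyInstr RegisterProgram Relation

/-- The `r`-th prime. -/
noncomputable def registerPrime (r : ℕ) : ℕ := Nat.nth Nat.Prime r

theorem registerPrime_prime (r : ℕ) : (registerPrime r).Prime :=
  Nat.prime_nth_prime r

theorem registerPrime_injective : Function.Injective registerPrime :=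
  Nat.nth_injective Nat.infinite_setOfPred_prime

/-- The number `∏ p_r ^ s_r` that stores the register contents `s` in one counter. -/
noncomputable def godelNumber (s : ℕ →₀ ℕ) : ℕ := s.prod fun r e => registerPrime r ^ e

/-- Increment becomes multiplication by `registerPrime r`, decrement exact division
(`godelNumber_eq_mul`), and the zero test non-divisibility (`not_registerPrime_dvd`). -/
theorem godelNumber_update_succ (s : ℕ →₀ ℕ) (r : ℕ) :
    godelNumber (s.update r (s r + 1)) = registerPrime r * godelNumber s := by
  have : s.update r (s r + 1) = Finsupp.single r 1 + s := by
    ext j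
    simp only [Finsupp.update_apply, Finsupp.add_apply, Finsupp.single_apply]
    grind
  rw [this, godelNumber, Finsupp.prod_add_index' (by simp) (by simp [pow_add]),
    Finsupp.prod_single_index (by simp), pow_one, godelNumber]

theorem godelNumber_eq_mul {s : ℕ →₀ ℕ} {r : ℕ} (h : s r ≠ 0) :
    godelNumber s = registerPrime r * godelNumber (s.update r (s r - 1)) := by
  rw [← godelNumber_update_succ]
  congr 1
  ext j
  simp only [Finsupp.update_apply]
  grind

theorem not_registerPrime_dvd {s : ℕ →₀ ℕ} {r : ℕ} (h : s r = 0) :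
    ¬ registerPrime r ∣ godelNumber s := by
  intro hd
  obtain ⟨j, hj, hdvd⟩ := (registerPrime_prime r).prime.exists_mem_finset_dvd hd
  have := (Nat.prime_dvd_prime_iff_eq (registerPrime_prime r) (registerPrime_prime j)).mp
    ((registerPrime_prime r).dvd_of_dvd_pow hdvd)
  rw [Finsupp.mem_support_iff, ← registerPrime_injective this] at hj
  exact hj h

/-- The block `δ` at the addresses from `a` up to `b` carries out `P` on Gödel numbers. -/
def Implements (P : RegisterProgram) (δ : ℕ → MinskyInstr ℕ) (a b : ℕ) : Prop :=
  ∀ (Q : Type) (D : Q → MinskyInstr Q) (ℓ : ℕ → Q), Contains D ℓ δ a b →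
    ∀ s s', P.Eval s s' →
      ReflTransGen (Step D) (ℓ a, ![godelNumber s, 0]) (ℓ b, ![godelNumber s', 0])

/-- The block for `loop r P`, where `δ` is the block for `P` at the addresses from
`a + 2 * registerPrime r + 4` up to `b`. -/
noncomputable def loopBlock (r : ℕ) (δ : ℕ → MinskyInstr ℕ) (a b x : ℕ) : MinskyInstr ℕ :=
  if x < a + 2 * registerPrime r + 4 then divBlock (registerPrime r) a (b + 1) x
  else if x < b then δ x else dec 1 a a

section Loop

variable {r a b : ℕ} {δ : ℕ → MinskyInstr ℕ} {P : RegisterProgram} {Q : Type}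
  {D : Q → MinskyInstr Q} {ℓ : ℕ → Q}

theorem loopBlock_zero (hb : a + 2 * registerPrime r + 4 ≤ b)
    (h : Contains D ℓ (loopBlock r δ a b) a (b + 1)) {s : ℕ →₀ ℕ} (hs : s r = 0) :
    ReflTransGen (Step D) (ℓ a, ![godelNumber s, 0]) (ℓ (b + 1), ![godelNumber s, 0]) :=
  divBlock_not_dvd (h.restrict le_rfl (by omega) fun _ _ hx => if_pos hx)
    (registerPrime_prime r).pos (not_registerPrime_dvd hs)

/-- One round of the loop. At least one move is recorded because `not_halts_of_invariant` needs it.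
-/
theorem loopBlock_pos (hb : a + 2 * registerPrime r + 4 ≤ b)
    (hP : Implements P δ (a + 2 * registerPrime r + 4) b)
    (h : Contains D ℓ (loopBlock r δ a b) a (b + 1)) {s s' : ℕ →₀ ℕ} (hs : s r ≠ 0)
    (hs' : P.Eval (s.update r (s r - 1)) s') :
    TransGen (Step D) (ℓ a, ![godelNumber s, 0]) (ℓ a, ![godelNumber s', 0]) := by
  have h₁ := divBlock_dvd (out := b + 1)
    (h.restrict le_rfl (by omega) fun _ _ hx => if_pos hx)
    (registerPrime_prime r).pos (godelNumber (s.update r (s r - 1)))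
  rw [← godelNumber_eq_mul hs] at h₁
  have h₂ := hP Q D ℓ (h.restrict (by omega) (by omega) fun x hx hx' => by
    rw [loopBlock, if_neg (by omega), if_pos hx']) _ _ hs'
  -- Both targets agree and counter `1` is `0` here, so this is a plain jump back.
  have hd : D (ℓ b) = dec 1 (ℓ a) (ℓ a) := by
    rw [h _ (by omega) (by omega), loopBlock, if_neg (by omega), if_neg (by omega)]
    rfl
  exact (h₁.trans_left h₂).tail (step_dec_zero hd (by simp))

end Loop

/-- Every structured program can be carried out by a two-counter machine. -/
theorem exists_implements (P : RegisterProgram) (a : ℕ) : ∃ b δ, a ≤ b ∧ Implements P δ a b := by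
  induction P generalizing a with
  | skip =>
    refine ⟨a, fun _ => halt, le_rfl, fun Q D ℓ _ s s' hs => ?_⟩
    cases hs
    exact ReflTransGen.refl
  | inc r =>
    refine ⟨a + registerPrime r + 3, mulBlock (registerPrime r) a, by omega,
      fun Q D ℓ h s s' hs => ?_⟩
    cases hs
    rw [godelNumber_update_succ]
    exact mulBlock_reaches h _
  | seq P R ihP ihR =>
    obtain ⟨b, δ, hab, hP⟩ := ihP a
    obtain ⟨c, δ', hbc, hR⟩ := ihR b
    refine ⟨c, fun x => if x < b then δ x else δ' x, hab.trans hbc, fun Q D ℓ h s s'' hs => ?_⟩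
    cases hs with
    | seq h₁ h₂ =>
      exact (hP Q D ℓ (h.restrict le_rfl hbc fun _ _ hx => if_pos hx) _ _ h₁).trans
        (hR Q D ℓ (h.restrict hab le_rfl fun _ hx _ => if_neg (by omega)) _ _ h₂)
  | loop r P ih =>
    obtain ⟨b, δ, hb, hP⟩ := ih (a + 2 * registerPrime r + 4)
    refine ⟨b + 1, loopBlock r δ a b, by omega, fun Q D ℓ h s s' hs => ?_⟩
    -- The induction is over the rounds of the evaluation, for which the program index has to be a
    -- variable.
    generalize hL : RegisterProgram.loop r P = L at hs
    induction hs with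
    | loop_zero hz =>
      cases hL
      exact loopBlock_zero hb h hz
    | loop_pos hz h₁ _ _ ih₂ =>
      cases hL
      exact (loopBlock_pos hb hP h hz h₁).to_reflTransGen.trans (ih₂ rfl)
    | _ => cases hL

end Minsky

/-! ### Register programs for primitive recursive functions. -/

namespace RegisterProgram

theorem Eval.of_eq {P : RegisterProgram} {s s' s'' : ℕ →₀ ℕ} (h : P.Eval s s')
    (H : ∀ j, s' j = s'' j) : P.Eval s s'' :=
  Finsupp.ext H ▸ h

/-- Set register `r` to `0`. -/
def clear (r : ℕ) : RegisterProgram := loop r skip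

theorem eval_clear (r : ℕ) (s : ℕ →₀ ℕ) : (clear r).Eval s (s.update r 0) := by
  induction hk : s r generalizing s with
  | zero =>
    rw [← hk, Finsupp.update_self]
    exact .loop_zero hk
  | succ k ih =>
    refine .loop_pos (by omega) .skip ?_
    have := ih (s.update r (s r - 1)) (by simp [Finsupp.update_apply, hk])
    rwa [Finsupp.update_idem] at this

/-- Add register `a` to register `o` and to register `t`, and clear it. -/
def moveTwo (a o t : ℕ) : RegisterProgram := loop a (seq (inc o) (inc t))

theorem eval_moveTwo {a o t : ℕ} (hao : a ≠ o) (hat : a ≠ t) (hot : o ≠ t) (s : ℕ →₀ ℕ) :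
    (moveTwo a o t).Eval s
      (((s.update a 0).update o (s o + s a)).update t (s t + s a)) := by
  induction hk : s a generalizing s with
  | zero =>
    refine (Eval.loop_zero hk).of_eq fun j => ?_
    simp only [Finsupp.update_apply]
    grind
  | succ k ih =>
    refine .loop_pos (by omega) (.seq .inc .inc) ?_
    refine (ih _ ?_).of_eq fun j => ?_
    all_goals
      simp only [Finsupp.update_apply]
      grind

/-- Add register `a` to register `o`, and clear it. -/
def move (a o : ℕ) : RegisterProgram := loop a (inc o)

theorem eval_move {a o : ℕ} (hao : a ≠ o) (s : ℕ →₀ ℕ) :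
    (move a o).Eval s ((s.update a 0).update o (s o + s a)) := by
  induction hk : s a generalizing s with
  | zero =>
    refine (Eval.loop_zero hk).of_eq fun j => ?_
    simp only [Finsupp.update_apply]
    grind
  | succ k ih =>
    refine .loop_pos (by omega) .inc ?_
    refine (ih _ ?_).of_eq fun j => ?_
    all_goals
      simp only [Finsupp.update_apply]
      grind

/-- Add register `a` to register `o`, using the empty register `t`. -/
def copy (a o t : ℕ) : RegisterProgram := seq (moveTwo a o t) (move t a)

theorem eval_copy {a o t : ℕ} (hao : a ≠ o) (hat : a ≠ t) (hot : o ≠ t) {s : ℕ →₀ ℕ}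
    (ht : s t = 0) : (copy a o t).Eval s (s.update o (s o + s a)) := by
  refine .seq (eval_moveTwo hao hat hot s) ?_
  refine (eval_move hat.symm _).of_eq fun j => ?_
  simp only [Finsupp.update_apply]
  grind

end RegisterProgram

namespace RegisterProgram

/-- For all argument registers `v`, every output register `o` and every bound `b` on these, some
program computes `f` into the empty register `o`, with the empty registers from `b` on as workspace,
which it leaves empty. -/
def Computable {n : ℕ} (f : List.Vector ℕ n → ℕ) : Prop :=
  ∀ (v : List.Vector ℕ n) (o b : ℕ), (∀ i, v.get i < b) → (∀ i, v.get i ≠ o) → o < b →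
    ∃ P : RegisterProgram, ∀ s : ℕ →₀ ℕ, (∀ r, b ≤ r → s r = 0) → s o = 0 →
      P.Eval s (s.update o (f (v.map s)))

theorem map_vector_congr {n : ℕ} {v : List.Vector ℕ n} {s s' : ℕ → ℕ}
    (h : ∀ i, s (v.get i) = s' (v.get i)) : v.map s = v.map s' := by
  ext i
  simp [List.Vector.get_map, h]

theorem computable_zero : Computable (n := 0) fun _ => 0 := by
  refine fun v o b _ _ _ => ⟨skip, fun s _ ho => Eval.skip.of_eq fun j => ?_⟩
  simp only [Finsupp.update_apply]
  grind

theorem computable_get {n : ℕ} (i : Fin n) : Computable fun v : List.Vector ℕ n => v.get i := by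
  refine fun v o b hb ho hob => ⟨copy (v.get i) o b, fun s hs hso => ?_⟩
  refine (eval_copy (ho i) (hb i).ne hob.ne (hs b le_rfl)).of_eq fun j => ?_
  simp only [hso, zero_add, List.Vector.get_map]

theorem computable_succ : Computable (n := 1) fun v => v.head.succ := by
  intro v o b hb ho hob
  obtain ⟨P, hP⟩ := computable_get 0 v o b hb ho hob
  refine ⟨seq P (inc o), fun s hs hso => (Eval.seq (hP s hs hso) .inc).of_eq fun j => ?_⟩
  simp only [Finsupp.update_apply, List.Vector.get_zero]
  grind

/-- Computing several functions one after the other. -/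
theorem exists_eval_family {m n : ℕ} {g : Fin n → List.Vector ℕ m → ℕ} (hg : ∀ i, Computable (g i))
    (v : List.Vector ℕ m) (b : ℕ) (hb : ∀ i, v.get i < b) (k : ℕ) (hk : k ≤ n) :
    ∃ P : RegisterProgram, ∀ s : ℕ →₀ ℕ, (∀ r, b ≤ r → s r = 0) → ∃ s', P.Eval s s' ∧
      (∀ i : Fin n, i < k → s' (b + i) = g i (v.map s)) ∧
      ∀ j, j < b ∨ b + k ≤ j → s' j = s j := by
  induction k with
  | zero => exact ⟨skip, fun s _ => ⟨s, .skip, fun i hi => absurd hi (by omega), fun j _ => rfl⟩⟩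
  | succ k ih =>
    obtain ⟨P, hP⟩ := ih (by omega)
    -- The workspace starts at `b + n`, beyond all outputs, so the results already in `b, …, b + k -
    -- 1` survive.
    obtain ⟨R, hR⟩ := hg ⟨k, hk⟩ v (b + k) (b + n) (fun i => (hb i).trans_le (by omega))
      (fun i => by have := hb i; omega) (by omega)
    refine ⟨seq P R, fun s hs => ?_⟩
    obtain ⟨s', he, h₁, h₂⟩ := hP s hs
    have hv : v.map s' = v.map s := map_vector_congr fun i => h₂ _ (.inl (hb i))
    refine ⟨_, .seq he (hR s' (fun r hr => ?_) ?_), fun i hi => ?_, fun j hj => ?_⟩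
    · rw [h₂ r (.inr (by omega)), hs r (by omega)]
    · rw [h₂ _ (.inr le_rfl), hs _ (by omega)]
    · rw [hv, Finsupp.update_apply]
      split_ifs with h
      · obtain rfl : i = ⟨k, hk⟩ := Fin.ext (by simpa using h)
        rfl
      · exact h₁ i (by omega)
    · rw [Finsupp.update_apply, if_neg (by omega), h₂ j (by omega)]

/-- Clearing the registers from `b` up to `b + k`. -/
theorem exists_eval_clear (b k : ℕ) : ∃ P : RegisterProgram, ∀ s : ℕ →₀ ℕ, ∃ s', P.Eval s s' ∧
    ∀ j, s' j = if b ≤ j ∧ j < b + k then 0 else s j := by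
  induction k with
  | zero => exact ⟨skip, fun s => ⟨s, .skip, fun j => by grind⟩⟩
  | succ k ih =>
    obtain ⟨P, hP⟩ := ih
    refine ⟨seq P (clear (b + k)), fun s => ?_⟩
    obtain ⟨s', he, h⟩ := hP s
    refine ⟨_, .seq he (eval_clear _ s'), fun j => ?_⟩
    simp only [Finsupp.update_apply, h]
    grind

/-- The inner values go to `b, …, b + n - 1`, are read by the program for `f`, and are then cleared
to leave the workspace empty. -/
theorem Computable.comp {m n : ℕ} {f : List.Vector ℕ n → ℕ} {g : Fin n → List.Vector ℕ m → ℕ}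
    (hf : Computable f) (hg : ∀ i, Computable (g i)) :
    Computable fun a => f (List.Vector.ofFn fun i => g i a) := by
  intro v o b hb ho hob
  obtain ⟨P, hP⟩ := exists_eval_family hg v b hb n le_rfl
  obtain ⟨R, hR⟩ := hf (List.Vector.ofFn fun i => b + i) o (b + n) (fun i => by simp)
    (fun i => by simp; omega) (by omega)
  obtain ⟨C, hC⟩ := exists_eval_clear b n
  refine ⟨seq P (seq R C), fun s hs hso => ?_⟩
  obtain ⟨s', he, h₁, h₂⟩ := hP s hs
  have hR' := hR s' (fun r hr => by rw [h₂ r (.inr hr), hs r (by omega)])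
    (by rw [h₂ o (.inl hob), hso])
  have hv : (List.Vector.ofFn fun i : Fin n => b + i).map s' =
      List.Vector.ofFn fun i => g i (v.map s) := by
    ext i
    simp [List.Vector.get_map, h₁]
  rw [hv] at hR'
  obtain ⟨s'', he', h⟩ := hC (s'.update o (f (List.Vector.ofFn fun i => g i (v.map s))))
  refine (Eval.seq he (.seq hR' he')).of_eq fun j => ?_
  simp only [h, Finsupp.update_apply]
  grind

/-- Layout: `b` holds the remaining rounds, `b + 1` the recursion index, `b + 2` the current value,
`b + 3` the next value; the workspace starts at `b + 4`. -/
theorem Computable.prec {n : ℕ} {f : List.Vector ℕ n → ℕ} {g : List.Vector ℕ (n + 2) → ℕ}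
    (hf : Computable f) (hg : Computable g) :
    Computable fun v : List.Vector ℕ (n + 1) =>
      v.head.rec (f v.tail) fun y IH => g (y ::ᵥ IH ::ᵥ v.tail) := by
  intro v o b hb ho hob
  have hh : v.head < b ∧ v.head ≠ o := by
    simpa using And.intro (hb 0) (ho 0)
  have ht : ∀ i : Fin n, v.tail.get i < b ∧ v.tail.get i ≠ o := fun i => by
    simpa [List.Vector.get_tail_succ] using And.intro (hb i.succ) (ho i.succ)
  have hc : ∀ i, ((b + 1) ::ᵥ (b + 2) ::ᵥ v.tail).get i < b + 3 :=
    Fin.cases (by simp) <| Fin.cases (by rw [List.Vector.get_cons_succ]; simp) fun i => by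
      have := ht i
      simp only [List.Vector.get_cons_succ]
      omega
  obtain ⟨P, hP⟩ := hf v.tail (b + 2) (b + 4) (fun i => by have := ht i; omega)
    (fun i => by have := ht i; omega) (by omega)
  obtain ⟨R, hR⟩ := hg ((b + 1) ::ᵥ (b + 2) ::ᵥ v.tail) (b + 3) (b + 4)
    (fun i => by have := hc i; omega)
    (fun i => by have := hc i; omega) (by omega)
  -- Loop invariant: `b + 2` holds the value of the recursion at the index in `b + 1`. The starting
  -- index is arbitrary, so that induction on the remaining rounds applies.
  have hloop : ∀ (w : List.Vector ℕ n) (k : ℕ) (s : ℕ →₀ ℕ), v.tail.map s = w →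
      (∀ r, b + 3 ≤ r → s r = 0) → s b = k →
      s (b + 2) = (s (b + 1)).rec (f w) (fun y IH => g (y ::ᵥ IH ::ᵥ w)) →
      (loop b (seq R (seq (clear (b + 2)) (seq (move (b + 3) (b + 2)) (inc (b + 1)))))).Eval s
        (((s.update b 0).update (b + 1) (s (b + 1) + k)).update (b + 2)
          ((s (b + 1) + k).rec (f w) fun y IH => g (y ::ᵥ IH ::ᵥ w))) := by
    intro w k
    induction k with
    | zero =>
      intro s _ _ hk hIH
      refine (Eval.loop_zero hk).of_eq fun j => ?_
      simp only [Finsupp.update_apply, add_zero]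
      grind
    | succ k ih =>
      intro s hw hs hk hIH
      have hw' : v.tail.map (s.update b (s b - 1)) = w := by
        rw [← hw]
        refine map_vector_congr fun i => ?_
        rw [Finsupp.update_apply, if_neg (ht i).1.ne]
      have h₁ := hR (s.update b (s b - 1))
        (fun r hr => by rw [Finsupp.update_apply, if_neg (by omega), hs r (by omega)])
        (by rw [Finsupp.update_apply, if_neg (by omega), hs _ le_rfl])
      rw [List.Vector.map_cons, List.Vector.map_cons, hw'] at h₁
      simp only [Finsupp.update_apply, hIH, show b + 1 ≠ b by omega, show b + 2 ≠ b by omega,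
        if_false] at h₁
      refine .loop_pos (by omega) (.seq h₁ (.seq (eval_clear _ _)
        (.seq (eval_move (by omega) _) .inc))) ?_
      refine (ih _ ?_ ?_ ?_ ?_).of_eq fun j => ?_
      · rw [← hw]
        refine map_vector_congr fun i => ?_
        have := ht i
        simp only [Finsupp.update_apply]
        grind
      · intro r hr
        have := hs r hr
        simp only [Finsupp.update_apply]
        grind
      · simp only [Finsupp.update_apply]
        grind
      · simp [Finsupp.update_apply]
      · simp only [Finsupp.update_apply]
        grind
  refine ⟨seq (copy v.head b (b + 1)) (seq P (seq (loop b
    (seq R (seq (clear (b + 2)) (seq (move (b + 3) (b + 2)) (inc (b + 1))))))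
    (seq (clear (b + 1)) (move (b + 2) o)))), fun s hs hso => ?_⟩
  have h₁ := eval_copy (s := s) (t := b + 1) hh.1.ne (by omega) (by omega) (hs _ (by omega))
  rw [hs b le_rfl, zero_add] at h₁
  have h₂ := hP (s.update b (s v.head))
    (fun r hr => by rw [Finsupp.update_apply, if_neg (by omega), hs r (by omega)])
    (by rw [Finsupp.update_apply, if_neg (by omega), hs _ (by omega)])
  have hw : v.tail.map (s.update b (s v.head)) = v.tail.map s :=
    map_vector_congr fun i => by rw [Finsupp.update_apply, if_neg (ht i).1.ne]
  rw [hw] at h₂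
  have h₃ := hloop (v.tail.map s) (s v.head)
    ((s.update b (s v.head)).update (b + 2) (f (v.tail.map s)))
    (map_vector_congr fun i => by
      have := ht i
      simp only [Finsupp.update_apply]
      grind)
    (fun r hr => by
      have := hs r (by omega)
      simp only [Finsupp.update_apply]
      grind)
    (by simp [Finsupp.update_apply])
    (by simp [Finsupp.update_apply, hs (b + 1)])
  have hhead : (v.map s).head = s v.head := by
    rw [← List.Vector.get_zero, List.Vector.get_map, List.Vector.get_zero]
  have htail : (v.map s).tail = v.tail.map s := by
    ext i
    simp [List.Vector.get_tail_succ, List.Vector.get_map]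
  simp only [hhead, htail]
  refine (Eval.seq h₁ (.seq h₂ (.seq h₃ (.seq (eval_clear _ _)
    (eval_move (by omega) _))))).of_eq fun j => ?_
  have h₀ := hs b le_rfl
  have h₁ := hs (b + 1) (by omega)
  have h₂ := hs (b + 2) (by omega)
  clear * - h₀ h₁ h₂ hso hob
  simp only [Finsupp.update_apply, h₁, hso, show b + 1 ≠ b + 2 by omega, show b + 1 ≠ b by omega,
    show b + 2 ≠ b + 1 by omega, show o ≠ b by omega, show o ≠ b + 1 by omega,
    show o ≠ b + 2 by omega, if_true, if_false, zero_add]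
  split_ifs <;> simp_all

theorem computable_of_primrec {n : ℕ} {f : List.Vector ℕ n → ℕ} (hf : Nat.Primrec' f) :
    Computable f := by
  induction hf with
  | zero => exact computable_zero
  | succ => exact computable_succ
  | get i => exact computable_get i
  | comp g _ _ hf hg => exact hf.comp hg
  | prec _ _ hf hg => exact hf.prec hg

end RegisterProgram

/-! ### A two-counter program with undecidable halting problem. -/

namespace Minsky

open MinskyInstr RegisterProgram Relation Nat.Partrec

/-- `0` if the program with number `n` stops on input `0` within the bound `k`, otherwise `1`. -/
def haltingTest (n k : ℕ) : ℕ :=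
  if (Code.evaln k (Denumerable.ofNat Code n) 0).isSome then 0 else 1

theorem primrec_haltingTest : Primrec₂ haltingTest := by
  refine Primrec.ite (Primrec.eq.comp (Primrec.option_isSome.comp (Code.primrec_evaln.comp
    ((Primrec.snd.pair ((Primrec.ofNat Code).comp Primrec.fst)).pair (Primrec.const 0))))
    (Primrec.const true)) (Primrec.const 0) (Primrec.const 1)

theorem exists_haltingTest_eq_zero (c : Code) :
    (∃ k, haltingTest (Encodable.encode c) k = 0) ↔ (c.eval 0).Dom := by
  simp only [haltingTest, Denumerable.ofNat_encode, ite_eq_left_iff, one_ne_zero, imp_false,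
    not_not, Option.isSome_iff_exists, Part.dom_iff_mem, Code.evaln_complete, Option.mem_def]
  exact exists_comm

/-- The register contents `n, k, e, 0, 0, …`. -/
noncomputable def threeRegisters (n k e : ℕ) : ℕ →₀ ℕ :=
  ((Finsupp.single 0 n).update 1 k).update 2 e

theorem threeRegisters_apply (n k e j : ℕ) :
    threeRegisters n k e j = if j = 2 then e else if j = 1 then k else if j = 0 then n else 0 := by
  simp only [threeRegisters, Finsupp.update_apply, Finsupp.single_apply]
  grind

/-- One round of the search for a bound `k` that passes the halting test. -/
theorem exists_eval_search : ∃ P : RegisterProgram, ∀ n k e,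
    P.Eval ((threeRegisters n k e).update 2 (e - 1))
      (threeRegisters n (k + 1) (haltingTest n k)) := by
  obtain ⟨P, hP⟩ := computable_of_primrec (Nat.Primrec'.prim_iff₂.mpr primrec_haltingTest)
    (0 ::ᵥ 1 ::ᵥ List.Vector.nil) 2 3
    (Fin.cases (by simp) (Fin.cases (by rw [List.Vector.get_cons_succ]; simp) fun i => i.elim0))
    (Fin.cases (by simp) (Fin.cases (by rw [List.Vector.get_cons_succ]; simp) fun i => i.elim0))
    (by omega)
  -- Register `2` holds the loop condition and is also the output of the test, which has to be empty
  -- beforehand.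
  refine ⟨seq (clear 2) (seq P (.inc 1)), fun n k e => ?_⟩
  have h := hP (threeRegisters n k 0)
    (fun r hr => by rw [threeRegisters_apply]; grind) (by simp [threeRegisters_apply])
  simp only [List.Vector.map_cons, List.Vector.head_cons, List.Vector.tail_cons,
    threeRegisters_apply] at h
  refine (Eval.seq ((eval_clear 2 _).of_eq (s'' := threeRegisters n k 0) fun j => ?_)
    (.seq h .inc)).of_eq fun j => ?_
  · simp only [Finsupp.update_apply, threeRegisters_apply]
    grind
  · simp only [Finsupp.update_apply, threeRegisters_apply]
    grind

/-- A two-counter machine whose halting problem is at least as hard as that of the programs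
`Nat.Partrec.Code` on input `0`. -/
theorem exists_universal : ∃ (N : ℕ) (D : Fin N → MinskyInstr (Fin N)) (q₀ qf : Fin N),
    ∀ c : Code,
      (∃ z, ReflTransGen (Step D)
        (q₀, ![godelNumber (threeRegisters (Encodable.encode c) 0 1), 0]) (qf, z)) ↔
      (c.eval 0).Dom := by
  obtain ⟨P, hP⟩ := exists_eval_search
  obtain ⟨b, δ, hb, hδ⟩ := exists_implements P (0 + 2 * registerPrime 2 + 4)
  -- Addresses `0, …, b` hold the search loop on register `2`; its exit `b + 1` is the halting
  -- state. Reduction modulo `b + 2` fixes all of these.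
  let ℓ : ℕ → Fin (b + 2) := Fin.ofNat (b + 2)
  let D : Fin (b + 2) → MinskyInstr (Fin (b + 2)) := fun q =>
    if q.val = b + 1 then halt else (loopBlock 2 δ 0 b q).map ℓ
  have hℓ : ∀ x, x < b + 2 → (ℓ x).val = x := fun x hx => Nat.mod_eq_of_lt hx
  have hD : Contains D ℓ (loopBlock 2 δ 0 b) 0 (b + 1) := fun x _ hx => by
    simp only [D, hℓ x (by omega), if_neg hx.ne]
  have hf : D (ℓ (b + 1)) = halt := if_pos (hℓ _ (by omega))
  have hround : ∀ n k e, e ≠ 0 → TransGen (Step D)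
      (ℓ 0, ![godelNumber (threeRegisters n k e), 0])
      (ℓ 0, ![godelNumber (threeRegisters n (k + 1) (haltingTest n k)), 0]) := fun n k e he =>
    loopBlock_pos hb hδ hD (by simpa [threeRegisters_apply] using he)
      (by simpa [threeRegisters_apply] using hP n k e)
  have hexit : ∀ n k, ReflTransGen (Step D) (ℓ 0, ![godelNumber (threeRegisters n k 0), 0])
      (ℓ (b + 1), ![godelNumber (threeRegisters n k 0), 0]) := fun n k =>
    loopBlock_zero hb hD (by simp [threeRegisters_apply])
  -- Induction on the distance `d` to a successful bound; the loop may stop earlier, hence the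
  -- arbitrary `e`.
  have hhalt : ∀ n d k e, haltingTest n (k + d) = 0 → ∃ z, ReflTransGen (Step D)
      (ℓ 0, ![godelNumber (threeRegisters n k e), 0]) (ℓ (b + 1), z) := by
    intro n d
    induction d with
    | zero =>
      intro k e h
      rcases eq_or_ne e 0 with rfl | he
      · exact ⟨_, hexit n k⟩
      · have := (hround n k e he).to_reflTransGen
        rw [show haltingTest n k = 0 from h] at this
        exact ⟨_, this.trans (hexit n (k + 1))⟩
    | succ d ih =>
      intro k e h
      rcases eq_or_ne e 0 with rfl | he
      · exact ⟨_, hexit n k⟩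
      · obtain ⟨z, hz⟩ := ih (k + 1) (haltingTest n k) (by rwa [add_right_comm, add_assoc])
        exact ⟨z, (hround n k e he).to_reflTransGen.trans hz⟩
  refine ⟨b + 2, D, ℓ 0, ℓ (b + 1), fun c => ?_⟩
  rw [← exists_haltingTest_eq_zero]
  constructor
  · rintro ⟨z, hz⟩
    by_contra! hne
    -- If the test never yields `0`, each round returns to the loop head with a positive condition.
    refine not_halts_of_invariant (D := D) (I := fun a => ∃ k e, e ≠ 0 ∧
      a = (ℓ 0, ![godelNumber (threeRegisters (Encodable.encode c) k e), 0])) ?_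
      ⟨0, 1, one_ne_zero, rfl⟩ hf hz
    rintro _ ⟨k, e, he, rfl⟩
    exact ⟨_, ⟨k + 1, _, hne k, rfl⟩, hround _ k e he⟩
  · rintro ⟨k, hk⟩
    exact hhalt _ k 0 1 (by rwa [zero_add])

theorem godelNumber_threeRegisters (n : ℕ) :
    godelNumber (threeRegisters n 0 1) = registerPrime 0 ^ n * registerPrime 2 := by
  have : threeRegisters n 0 1 = Finsupp.single 0 n + Finsupp.single 2 1 := by
    ext j
    simp only [threeRegisters_apply, Finsupp.add_apply, Finsupp.single_apply]
    grind
  rw [this, godelNumber, Finsupp.prod_add_index' (by simp) (by simp [pow_add]),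
    Finsupp.prod_single_index (by simp), Finsupp.prod_single_index (by simp), pow_one]

/-- Only two fixed primes occur, so the noncomputable definition of `registerPrime` does no harm. -/
theorem primrec_godelNumber_threeRegisters :
    Primrec fun n => godelNumber (threeRegisters n 0 1) := by
  have hpow : Primrec fun n : ℕ => registerPrime 0 ^ n :=
    (Primrec.nat_rec₁ 1 (f := fun _ m => m * registerPrime 0)
      (Primrec.nat_mul.comp₂ Primrec₂.right (Primrec₂.const _))).of_eq
      fun n => by
        induction n with
        | zero => rfl
        | succ n ih => rw [pow_succ, ← ih]
  exact (Primrec.nat_mul.comp hpow (Primrec.const _)).of_eq fun n =>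
    (godelNumber_threeRegisters n).symm

end Minsky

/-! ### The counting machine and its store language. -/

namespace CounterMachine

open MinskyInstr Relation

variable {Q : Type}

/-- The transitions of `counting`. -/
inductive CountingTransition (r : Option (TapeSymbol Unit)) (D : Q → MinskyInstr Q) (q₀ : Q) :
    CounterTransition (Option Q) Unit 2 → Prop
  -- Every transition must test a counter; allowing both values of `p` makes the test vacuous.
  | count (p : Bool) : CountingTransition r D q₀ ⟨none, r, 0, p, none, 1⟩
  | finish (p : Bool) : CountingTransition r D q₀ ⟨none, some .endMarker, 0, p, some q₀, 0⟩
  | inc {q q' i} (p : Bool) (h : D q = inc i q') :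
      CountingTransition r D q₀ ⟨some q, none, i, p, some q', 1⟩
  | dec_pos {q q₁ q₂ i} (h : D q = dec i q₁ q₂) :
      CountingTransition r D q₀ ⟨some q, none, i, true, some q₁, -1⟩
  | dec_zero {q q₁ q₂ i} (h : D q = dec i q₁ q₂) :
      CountingTransition r D q₀ ⟨some q, none, i, false, some q₂, 0⟩

/-- The machine that in its start state `none` increments counter `0` whenever it reads `r`, and
after the end marker runs the program `D` from `q₀`, accepting in `qf`. -/
def counting (r : Option (TapeSymbol Unit)) (D : Q → MinskyInstr Q) (q₀ qf : Q) :
    CounterMachine (Option Q) Unit 2 where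
  transitions := {e | CountingTransition r D q₀ e}
  start := none
  final := {some qf}

variable {r : Option (TapeSymbol Unit)} {D : Q → MinskyInstr Q} {q₀ qf : Q}

theorem counting_step_count (w : List (TapeSymbol Unit)) (x y : ℕ) :
    (counting r D q₀ qf).Step ⟨none, r.toList ++ w, ![x, y]⟩ ⟨none, w, ![x + 1, y]⟩ := by
  refine ⟨_, .count (decide (0 < x)), ⟨rfl, List.prefix_append _ _, by simp⟩, rfl, rfl,
    fun i => ?_⟩
  fin_cases i <;> simp

theorem counting_step_finish (z : Fin 2 → ℕ) :
    (counting r D q₀ qf).Step ⟨none, [.endMarker], z⟩ ⟨some q₀, [], z⟩ :=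
  ⟨_, .finish (decide (0 < z 0)), ⟨rfl, by simp, by simp⟩, rfl, rfl, fun i => by simp⟩

theorem counting_step_of_minsky {q q' : Q} {z z' : Fin 2 → ℕ} (w : List (TapeSymbol Unit))
    (h : Minsky.Step D (q, z) (q', z')) :
    (counting r D q₀ qf).Step ⟨some q, w, z⟩ ⟨some q', w, z'⟩ := by
  unfold Minsky.Step at h
  cases hD : D q with
  | inc i q₁ =>
    simp only [hD, exec, Option.some.injEq, Prod.mk.injEq] at h
    obtain ⟨rfl, rfl⟩ := h
    refine ⟨_, .inc (decide (0 < z i)) hD, ⟨rfl, by simp, by simp⟩, rfl, rfl, fun j => ?_⟩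
    by_cases hj : j = i <;> simp [hj]
  | dec i q₁ q₂ =>
    simp only [hD, exec] at h
    split_ifs at h with hz <;> simp only [Option.some.injEq, Prod.mk.injEq] at h <;>
      obtain ⟨rfl, rfl⟩ := h
    · exact ⟨_, .dec_zero hD, ⟨rfl, by simp, by simp [hz]⟩, rfl, rfl, fun j => by simp⟩
    · refine ⟨_, .dec_pos hD, ⟨rfl, by simp, by simp; omega⟩, rfl, rfl, fun j => ?_⟩
      by_cases hj : j = i
      · subst hj
        simp
        omega
      · simp [hj]
  | halt => simp [hD, exec] at h

theorem minsky_of_counting_step {q : Q} {w : List (TapeSymbol Unit)} {z : Fin 2 → ℕ}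
    {c : CounterConfig (Option Q) Unit 2} (h : (counting r D q₀ qf).Step ⟨some q, w, z⟩ c) :
    ∃ q' z', c = ⟨some q', w, z'⟩ ∧ Minsky.Step D (q, z) (q', z') := by
  obtain ⟨c₁, c₂, c₃⟩ := c
  obtain ⟨e, he, ⟨h₁, -, h₃⟩, h₄, h₅, h₆⟩ := h
  cases he with
  | count p => simp at h₁
  | finish p => simp at h₁
  | @inc q' q₁ i p hD =>
    simp only [Option.some.injEq, Option.toList_none, List.nil_append] at h₁ h₄ h₅ h₆
    subst h₁ h₄ h₅
    refine ⟨_, _, rfl, ?_⟩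
    have : c₃ = Function.update z i (z i + 1) := by
      funext j
      have := h₆ j
      by_cases hj : j = i
      · subst hj
        simp at this ⊢
        omega
      · simpa [hj] using this
    rw [this]
    exact Minsky.step_inc hD z
  | @dec_pos q' q₁ q₂ i hD =>
    simp only [Option.some.injEq, Option.toList_none, List.nil_append, iff_true] at h₁ h₃ h₄ h₅ h₆
    subst h₁ h₄ h₅
    refine ⟨_, _, rfl, ?_⟩
    have : c₃ = Function.update z i (z i - 1) := by
      funext j
      have := h₆ j
      by_cases hj : j = i
      · subst hj
        simp at this ⊢
        omega
      · simpa [hj] using this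
    rw [this]
    exact Minsky.step_dec_pos hD (by omega)
  | @dec_zero q' q₁ q₂ i hD =>
    simp only [Option.some.injEq, Option.toList_none, List.nil_append] at h₁ h₃ h₄ h₅ h₆
    subst h₁ h₄ h₅
    have : c₃ = z := by
      funext j
      simpa using h₆ j
    subst this
    exact ⟨_, _, rfl, Minsky.step_dec_zero hD (by simpa using h₃)⟩

theorem counting_reaches_of_minsky {a b : Q × (Fin 2 → ℕ)} (w : List (TapeSymbol Unit))
    (h : ReflTransGen (Minsky.Step D) a b) :
    (counting r D q₀ qf).Reaches ⟨some a.1, w, a.2⟩ ⟨some b.1, w, b.2⟩ :=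
  Relation.ReflTransGen.lift
    (fun a : Q × (Fin 2 → ℕ) => (⟨some a.1, w, a.2⟩ : CounterConfig (Option Q) Unit 2))
    (fun _ _ h => counting_step_of_minsky w h) _ _ h

theorem minsky_of_counting_reaches {q : Q} {w : List (TapeSymbol Unit)} {z : Fin 2 → ℕ}
    {c : CounterConfig (Option Q) Unit 2} (h : (counting r D q₀ qf).Reaches ⟨some q, w, z⟩ c) :
    ∃ q' z', c = ⟨some q', w, z'⟩ ∧ ReflTransGen (Minsky.Step D) (q, z) (q', z') := by
  induction h with
  | refl => exact ⟨q, z, rfl, .refl⟩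
  | tail _ h ih =>
    obtain ⟨q', z', rfl, h'⟩ := ih
    obtain ⟨q'', z'', rfl, h''⟩ := minsky_of_counting_step h
    exact ⟨q'', z'', rfl, h'.tail h''⟩

/-- In the start state the next symbol, letter or end marker, decides between `count` and `finish`;
elsewhere the instruction and the counter test decide. -/
theorem counting_deterministic (a : Unit) :
    (counting (some (.letter a)) D q₀ qf).Deterministic := by
  rintro c e₁ h₁ e₂ h₂ ⟨s₁, p₁, z₁⟩ ⟨s₂, p₂, z₂⟩
  cases h₁ <;> cases h₂ <;> simp_all
  all_goals
    obtain ⟨_, h⟩ := p₁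
    simp [← h] at p₂

theorem storeWord_pair {Q A : Type} (c : CounterConfig Q A 2) :
    storeWord c = Sum.inl c.state ::
      (List.replicate (c.counters 0) (Sum.inr 0) ++ List.replicate (c.counters 1) (Sum.inr 1)) := by
  simp [storeWord, List.finRange_succ]

theorem eq_of_storeWord_eq {Q A : Type} {c c' : CounterConfig Q A 2}
    (h : storeWord c = storeWord c') : c.state = c'.state ∧ c.counters = c'.counters := by
  classical
  rw [storeWord_pair, storeWord_pair, List.cons.injEq] at h
  refine ⟨Sum.inl_injective h.1, funext fun i => ?_⟩
  have := congrArg (List.countP fun x => decide (x = Sum.inr i)) h.2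
  fin_cases i <;> simpa [List.countP_replicate] using this

/-- Whatever input and history lead to this store word, the rest of an accepting computation is a
run of `D` from `(x, 0)`; conversely, `hw` makes the configuration reachable. -/
theorem storeWord_mem_counting {x : ℕ} {w : List Unit}
    (hw : (counting r D q₀ qf).Reaches ((counting r D q₀ qf).init w)
      ⟨none, [.endMarker], ![x, 0]⟩) :
    Sum.inl (some q₀) :: List.replicate x (Sum.inr 0) ∈ (counting r D q₀ qf).storeLanguage ↔
      ∃ z, ReflTransGen (Minsky.Step D) (q₀, ![x, 0]) (qf, z) := by
  have hs : Sum.inl (some q₀) :: List.replicate x (Sum.inr 0) =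
      storeWord (⟨some q₀, [], ![x, 0]⟩ : CounterConfig (Option Q) Unit 2) := by
    simp [storeWord_pair]
  rw [hs]
  constructor
  · rintro ⟨w', ⟨q, v, z⟩, f, -, hf, hacc, h⟩
    obtain ⟨h₁, h₂⟩ := eq_of_storeWord_eq h
    simp only at h₁ h₂
    subst h₁ h₂
    obtain ⟨q', z', rfl, h'⟩ := minsky_of_counting_reaches hf
    obtain rfl : q' = qf := Option.some.inj hacc.1
    exact ⟨z', h'⟩
  · rintro ⟨z, hz⟩
    exact ⟨w, _, _, hw.tail (counting_step_finish _), counting_reaches_of_minsky [] hz,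
      ⟨rfl, rfl⟩, rfl⟩

theorem counting_letter_reaches (x : ℕ) (a : Unit) :
    (counting (some (.letter a)) D q₀ qf).Reaches
      ((counting (some (.letter a)) D q₀ qf).init (List.replicate x a))
      ⟨none, [.endMarker], ![x, 0]⟩ := by
  suffices H : ∀ y, (counting (some (.letter a)) D q₀ qf).Reaches
      ⟨none, List.replicate x (.letter a) ++ [.endMarker], ![y, 0]⟩
      ⟨none, [.endMarker], ![y + x, 0]⟩ by
    have h0 : (fun _ => 0 : Fin 2 → ℕ) = ![0, 0] := by
      funext i; fin_cases i <;> rfl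
    simpa [init, counting, h0] using H 0
  induction x with
  | zero => exact fun y => .refl
  | succ x ih =>
    intro y
    have := Relation.ReflTransGen.head (counting_step_count (r := some (.letter a)) (D := D)
      (q₀ := q₀) (qf := qf) (List.replicate x (TapeSymbol.letter a) ++ [TapeSymbol.endMarker]) y 0) (ih (y + 1))
    rwa [add_right_comm, add_assoc] at this

theorem counting_guess_reaches (x : ℕ) :
    (counting none D q₀ qf).Reaches ((counting none D q₀ qf).init [])
      ⟨none, [.endMarker], ![x, 0]⟩ := by
  induction x with
  | zero =>
    have h0 : (fun _ => 0 : Fin 2 → ℕ) = ![0, 0] := by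
      funext i; fin_cases i <;> rfl
    simp only [init, h0, List.map_nil, List.nil_append]
    exact ReflTransGen.refl
  | succ x ih => exact ih.tail (counting_step_count _ x 0)

/-- All moves but `finish` are λ-moves, and `finish` needs the end marker as next symbol, so an
unread letter blocks the input forever. -/
theorem counting_guess_input {w : List Unit} (hw : w ≠ []) {c : CounterConfig (Option Q) Unit 2}
    (h : (counting none D q₀ qf).Reaches ((counting none D q₀ qf).init w) c) :
    c.input = w.map .letter ++ [.endMarker] := by
  induction h with
  | refl => rfl
  | tail _ h ih =>
    obtain ⟨e, he, -, -, h, -⟩ := h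
    rw [ih] at h
    cases he with
    | finish p =>
      obtain ⟨a, w, rfl⟩ := List.exists_cons_of_ne_nil hw
      simp at h
    | _ => exact h.symm

theorem counting_guess_acceptedLanguage {x : ℕ} {z : Fin 2 → ℕ}
    (h : ReflTransGen (Minsky.Step D) (q₀, ![x, 0]) (qf, z)) :
    (counting none D q₀ qf).acceptedLanguage = {[]} := by
  ext w
  constructor
  · rintro ⟨f, hf, -, hacc⟩
    by_contra hw
    rw [counting_guess_input hw hf] at hacc
    simp at hacc
  · rintro rfl
    exact ⟨_, ((counting_guess_reaches x).tail (counting_step_finish _)).trans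
      (counting_reaches_of_minsky [] h), rfl, rfl⟩

/-- A language is not recursive if the halting problem reduces to its words `a b ^ g(n)`. -/
theorem not_isRecursive_of_halting {α : Type} {L : Language α} {a b : α} {g : ℕ → ℕ}
    (hg : Primrec g) (h : ∀ c : Nat.Partrec.Code,
      a :: List.replicate (g (Encodable.encode c)) b ∈ L ↔ (c.eval 0).Dom) : ¬ L.IsRecursive := by
  rintro ⟨n, e, he⟩
  refine ComputablePred.halting_problem 0 (ComputablePred.computable_of_manyOneReducible
    (q := fun w : List (Fin n) => w.map e.symm ∈ L)
    ⟨fun c => e a :: (List.range (g (Encodable.encode c))).map fun _ => e b, ?_, fun c => ?_⟩ he)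
  · exact (Primrec.list_cons.comp (Primrec.const _) (Primrec.list_map
      (Primrec.list_range.comp (hg.comp Primrec.encode)) (Primrec.const (e b)).to₂)).to_comp
  · change (c.eval 0).Dom ↔ List.map e.symm (e a :: _) ∈ L
    rw [← h c]
    simp [List.map_const']

end CounterMachine

theorem mainTheorem9 :
    (∃ (Q A : Type) (_ : Finite Q) (_ : Finite A) (M : CounterMachine Q A 2),
      M.Deterministic ∧ ¬ M.storeLanguage.IsRecursive) ∧
    (∃ (Q A : Type) (_ : Finite Q) (_ : Finite A) (M : CounterMachine Q A 2),
      M.acceptedLanguage = {[]} ∧ ¬ M.storeLanguage.IsRecursive) := by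
  obtain ⟨N, D, q₀, qf, hD⟩ := Minsky.exists_universal
  refine ⟨⟨Option (Fin N), Unit, inferInstance, inferInstance,
    CounterMachine.counting (some (.letter ())) D q₀ qf,
    CounterMachine.counting_deterministic (), ?_⟩,
    ⟨Option (Fin N), Unit, inferInstance, inferInstance,
    CounterMachine.counting none D q₀ qf, ?_, ?_⟩⟩
  · exact CounterMachine.not_isRecursive_of_halting Minsky.primrec_godelNumber_threeRegisters
      fun c => (CounterMachine.storeWord_mem_counting
        (CounterMachine.counting_letter_reaches _ ())).trans (hD c)
  -- `Code.zero` halts, so `D` reaches `qf` from some guess and the empty word is indeed accepted.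
  · obtain ⟨z, hz⟩ := (hD .zero).mpr trivial
    exact CounterMachine.counting_guess_acceptedLanguage hz
  · exact CounterMachine.not_isRecursive_of_halting Minsky.primrec_godelNumber_threeRegisters
      fun c => (CounterMachine.storeWord_mem_counting
        (CounterMachine.counting_guess_reaches _)).trans (hD c)
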